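/- Let $d\ge 1$, $\lambda>0$, let $u:\mathbb Z^d\to\mathbb R$ and let $\mu$ be a probability measure on $\mathbb R$ with a bounded density $\rho$ that vanishes outside $[-1,1]$. Let $\mathbb P=\bigotimes_{k\in\mathbb Z^d}\mu$ on $\mathbb R^{\mathbb Z^d}$, so that the coordinates $\omega_k$ are i.i.d. with law $\mu$. For $x\in\mathbb Z^d$ and $L>0$ let $\Lambda_{L,x}=\{k\in\mathbb Z^d:|x-k|_\infty\le L\}$ and $\Lambda_L=\Lambda_{L,0}$. Consider the discrete alloy-type operator $H_\omega=-\Delta+\lambda V_\omega$, where $$(\Delta\psi)(x)=\sum_{|e|_1=1}\psi(x+e),\qquad V_\omega(x)=\sum_{k\in\mathbb Z^d}\omega_k\,u(x-k).$$ For finite $\Gamma\subset\mathbb Z^d$ let $H_{\omega,\Gamma}$ be the compression of $H_\omega$ to $\ell^2(\Gamma)$ (the matrix $(\langle\delta_x,H_\omega\delta_y\rangle)_{x,y\in\Gamma}$), and write $H_{\omega,L}=H_{\omega,\Lambda_L}$. Let $\|(H_{\omega,\Gamma}-E)^{-1}\|$ denote the operator norm, which is $+\infty$ if $E$ is an eigenvalue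 of $H_{\omega,\Gamma}$ and $0$ if $\Gamma=\emptyset$. Let $A_0>1$. Then there are constants $\delta>0$ and $C>0$, depending only on $d,\lambda,u,\mu,A_0$, such that the following holds for all $E\in\mathbb R$, $L>0$, $r\ge1$ and $A\ge A_0$. Assume 1. for $\mathbb P$-almost every $\omega$ there is $n\in\Lambda_L$ with $\|(H_{\omega,\Lambda_L\setminus\Lambda_{r,n}}-E)^{-1}\|\le A$; 2. for $\mathbb P$-almost every $\omega$ and every $n\in\Lambda_L$ there is $\tilde\omega\in\mathbb R^{\mathbb Z^d}$ with $\tilde\omega_m=\omega_m$ for all $m\ne n$, with $\tilde\omega_n\in[-1,1]$, and with $\|(H_{\tilde\omega,L}-E)^{-1}\|\le A$; 3. $\operatorname{supp}u\subset\Lambda_r$. Then for all $s\in\mathbb R$ $$\mathbb P\{\|(H_{\omega,L}-E)^{-1}\|\ge e^{s}\}\le C\,(2L+1)^d\,e^{-\frac{\delta s}{\log(A)\, r^d}},$$ and for all $s\ge C\,r^d\log(A)\log(L+2)$ $$\mathbb P\{\|(H_{\omega,L}-E)^{-1}\|\ge e^{s}\}\le e^{-\frac{\delta s}{\log(A)\,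 r^d}}.$$ -/

import Mathlib

open MeasureTheory

noncomputable section

namespace AlloyType

/-- The cube `Λ_{L,x} = {k ∈ ℤ^d : |x - k|_∞ ≤ L}`, see `mem_cube`. -/
def cube {d : ℕ} (L : ℝ) (x : Fin d → ℤ) : Finset (Fin d → ℤ) :=
  Finset.Icc (fun i => x i - ⌊L⌋) (fun i => x i + ⌊L⌋)

theorem mem_cube {d : ℕ} (L : ℝ) (x k : Fin d → ℤ) :
    k ∈ cube L x ↔ ∀ i, |((x i - k i : ℤ) : ℝ)| ≤ L := by
  have key : ∀ i, (|((x i - k i : ℤ) : ℝ)| ≤ L ↔ (x i - ⌊L⌋ ≤ k i ∧ k i ≤ x i + ⌊L⌋)) := by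
    intro i
    rw [← Int.cast_abs, ← Int.le_floor, abs_le]
    constructor <;> rintro ⟨h1, h2⟩ <;> constructor <;> omega
  simp only [cube, Finset.mem_Icc, Pi.le_def, key, forall_and]

/-- The alloy-type potential `V_ω(x) = ∑_{k ∈ ℤ^d} ω_k u(x - k)`. -/
def potential {d : ℕ} (u ω : (Fin d → ℤ) → ℝ) (x : Fin d → ℤ) : ℝ :=
  ∑' k : Fin d → ℤ, ω k * u (x - k)

/-- The discrete Laplacian `(Δψ)(x) = ∑_{|e|₁ = 1} ψ(x + e)` (the vectors `e ∈ ℤ^d` with `|e|₁ = 1`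
are plus and minus the standard unit vectors). -/
def laplacian {d : ℕ} (ψ : (Fin d → ℤ) → ℂ) (x : Fin d → ℤ) : ℂ :=
  ∑ i : Fin d, (ψ (x + Pi.single i 1) + ψ (x - Pi.single i 1))

/-- The Schrödinger operator `H_ω = -Δ + lam V_ω`, acting on functions on `ℤ^d`. -/
def hamiltonian {d : ℕ} (lam : ℝ) (u ω : (Fin d → ℤ) → ℝ) (ψ : (Fin d → ℤ) → ℂ)
    (x : Fin d → ℤ) : ℂ :=
  -laplacian ψ x + (lam : ℂ) * (potential u ω x : ℂ) * ψ x

/-- The restriction `H_{ω,Γ}` of `H_ω` to `ℓ²(Γ)`, for a finite set `Γ`, as the matrix with entries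
`⟨δ_x, H_ω δ_y⟩`, `x, y ∈ Γ`. -/
def boxHamiltonian {d : ℕ} (lam : ℝ) (u ω : (Fin d → ℤ) → ℝ) (Γ : Finset (Fin d → ℤ)) :
    Matrix Γ Γ ℂ :=
  Matrix.of fun x y => hamiltonian lam u ω (Pi.single (y : Fin d → ℤ) 1) x

open Classical in
/-- The operator norm on `ℓ²(Γ)` of the resolvent `(H_{ω,Γ} - E)⁻¹`, which is `∞` if `E` is in the
spectrum of `H_{ω,Γ}`. -/
def resolventNorm {d : ℕ} (lam : ℝ) (u ω : (Fin d → ℤ) → ℝ) (Γ : Finset (Fin d → ℤ)) (E : ℝ) :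
    ENNReal :=
  if IsUnit (boxHamiltonian lam u ω Γ - (E : ℂ) • (1 : Matrix Γ Γ ℂ)) then
    ENNReal.ofReal
      ‖Matrix.toEuclideanCLM (n := Γ) (𝕜 := ℂ)
        (boxHamiltonian lam u ω Γ - (E : ℂ) • (1 : Matrix Γ Γ ℂ))⁻¹‖
  else ⊤

/-- The law of an i.i.d. family `(ω_k)`, `k ∈ ℤ^d`, with common distribution `μ`. -/
def iidLaw (d : ℕ) (μ : Measure ℝ) [IsProbabilityMeasure μ] : Measure ((Fin d → ℤ) → ℝ) :=
  Measure.infinitePi fun _ : Fin d → ℤ => μ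

/-- For almost every `ω` some `n ∈ Λ_L` is such that the resolvent on `Λ_L` without the
cube `Λ_{r,n}` is bounded by `A`. -/
def RemovalBound {d : ℕ} (lam : ℝ) (u : (Fin d → ℤ) → ℝ) (μ : Measure ℝ) [IsProbabilityMeasure μ]
    (E L r A : ℝ) : Prop :=
  ∀ᵐ ω ∂(iidLaw d μ), ∃ n ∈ cube L (0 : Fin d → ℤ),
    resolventNorm lam u ω (cube L 0 \ cube r n) E ≤ ENNReal.ofReal A

/-- For almost every `ω` and every `n ∈ Λ_L`, one can change `ω` at the single site `n`, to a value
in `[-1, 1]`, so that the resolvent on `Λ_L` becomes bounded by `A`. -/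
def ModificationBound {d : ℕ} (lam : ℝ) (u : (Fin d → ℤ) → ℝ) (μ : Measure ℝ)
    [IsProbabilityMeasure μ] (E L A : ℝ) : Prop :=
  ∀ᵐ ω ∂(iidLaw d μ), ∀ n ∈ cube L (0 : Fin d → ℤ),
    ∃ ω' : (Fin d → ℤ) → ℝ, (∀ m, m ≠ n → ω' m = ω m) ∧ ω' n ∈ Set.Icc (-1 : ℝ) 1 ∧
      resolventNorm lam u ω' (cube L 0) E ≤ ENNReal.ofReal A

end AlloyType

end

/-
Changing a single coupling `ω_n` from `t₀` to `t` adds `t - t₀` times a diagonal matrix of rank at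
most `N = #Λ_r` to the restricted operator. By the Woodbury identity the resolvent norm at `t` is at
most `((1 + 2 * B) * A) ^ (3 * N) / |D t|` as soon as the one at `t₀` is at most `A`, where `B`
bounds `|λ u|` and the determinant `D t` is a product of `N` complex affine functions of `t`.
Each of these to the power `-1 / 2` has integral at most `12` over `[-1, 1]`, wherever its zero is,
so the inequalities of Hölder and Markov, applied to `|D| ^ (-1 / (2 * N))`, bound the measure
of the bad `t` by a constant times `A ^ (3 / 2) * e ^ (-s / (2 * N))`. Resampling `ω_n` turns
this into a bound on the probability. Raising that to the power `log A₀ / log A ≤ 1`,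
which does not decrease a number in `[0, 1]`, replaces `A ^ (3 / 2)` by the constant `A₀ ^ (3 / 2)`
at the cost of the factor `1 / log A` in the rate.
-/

noncomputable section

namespace AlloyType

section Matrix

variable {m ι K : Type*} [Fintype m] [DecidableEq m] [Fintype ι] [DecidableEq ι] [Field K]

theorem exists_charpoly_eq_prod_X_sub_C [IsAlgClosed K] (M : Matrix m m K) :
    ∃ ν : m → K, M.charpoly = ∏ i, (Polynomial.X - Polynomial.C (ν i)) := by
  classical
  have hsplits : M.charpoly.Splits := IsAlgClosed.splits _
  have hcard : Fintype.card m = Fintype.card M.charpoly.roots.ToType := by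
    rw [Multiset.card_coe, ← hsplits.natDegree_eq_card_roots, M.charpoly_natDegree_eq_dim]
  let e := Fintype.equivOfCardEq hcard
  refine ⟨fun i => (e i).1, ?_⟩
  calc M.charpoly = (M.charpoly.roots.map fun x => Polynomial.X - Polynomial.C x).prod :=
        hsplits.eq_prod_roots_of_monic M.charpoly_monic
    _ = ∏ x : M.charpoly.roots.ToType, (Polynomial.X - Polynomial.C x.1) := by
        rw [Finset.prod, Multiset.map_univ _ fun x => Polynomial.X - Polynomial.C x]
    _ = ∏ i, (Polynomial.X - Polynomial.C (e i).1) := (e.prod_comp _).symm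

theorem exists_det_one_add_smul_eq_prod [IsAlgClosed K] (M : Matrix m m K) :
    ∃ ν : m → K, ∀ τ : K, (1 + τ • M).det = ∏ i, (1 + τ * ν i) := by
  obtain ⟨ν, hν⟩ := exists_charpoly_eq_prod_X_sub_C M
  refine ⟨ν, fun τ => ?_⟩
  rcases eq_or_ne τ 0 with rfl | hτ
  · simp
  have hscalar : 1 + τ • M = (-τ) • (Matrix.scalar m (-τ⁻¹) - M) := by
    rw [smul_sub, Matrix.scalar_apply, ← Matrix.smul_one_eq_diagonal, smul_smul]
    simp [hτ]
  rw [hscalar, Matrix.det_smul, ← Matrix.eval_charpoly, hν, Polynomial.eval_prod,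
    ← Finset.card_univ, ← Finset.prod_const, ← Finset.prod_mul_distrib]
  refine Finset.prod_congr rfl fun i _ => ?_
  simp only [Polynomial.eval_sub, Polynomial.eval_X, Polynomial.eval_C]
  field_simp
  ring

theorem isUnit_add_mul {M : Matrix m m K} (hM : IsUnit M) (V : Matrix m ι K) {W : Matrix ι m K}
    (h : IsUnit (1 + W * M⁻¹ * V)) : IsUnit (M + V * W) := by
  rw [Matrix.isUnit_iff_isUnit_det] at hM h ⊢
  rw [Matrix.det_add_mul V W hM]
  exact hM.mul h

theorem inv_add_mul_eq_sub {M : Matrix m m K} (hM : IsUnit M) (V : Matrix m ι K)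
    {W : Matrix ι m K} (h : IsUnit (1 + W * M⁻¹ * V)) :
    (M + V * W)⁻¹ = M⁻¹ - M⁻¹ * V * (1 + W * M⁻¹ * V)⁻¹ * W * M⁻¹ := by
  simpa only [Matrix.mul_one, inv_one] using
    Matrix.add_mul_mul_inv_eq_sub M V 1 W hM isUnit_one (by simpa only [inv_one] using h)

theorem one_submatrix_mul_diagonal_mul_one_submatrix {α β R : Type*} [DecidableEq α]
    [DecidableEq β] [CommSemiring R] {w : α → R} {F : Finset α} (hw : ∀ a ∉ F, w a = 0)
    {f : β → α} (hf : Function.Injective f) :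
    (1 : Matrix α α R).submatrix f (Subtype.val : F → α) *
        ((Matrix.diagonal fun k : F => w k) *
          (1 : Matrix α α R).submatrix (Subtype.val : F → α) f) =
      Matrix.diagonal fun x => w (f x) := by
  ext x y
  rw [Matrix.mul_apply]
  simp only [Matrix.diagonal_mul, Matrix.submatrix_apply, Matrix.one_apply, Matrix.diagonal_apply,
    ite_mul, one_mul, zero_mul, mul_ite, mul_one, mul_zero]
  rw [Finset.sum_coe_sort F fun k => if k = f y then if f x = k then w k else 0 else 0,
    Finset.sum_ite_eq']
  rcases eq_or_ne x y with rfl | hxy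
  · simpa using fun hx => (hw _ hx).symm
  · simp only [hf.eq_iff, hxy, if_false, ite_self]

end Matrix

section OperatorNorm

open scoped Matrix Matrix.Norms.L2Operator ComplexOrder MatrixOrder

variable {m ι : Type*} [Fintype m] [DecidableEq m] [Fintype ι] [DecidableEq ι]

theorem eigenvalues_conjTranspose_mul_self_le (M : Matrix m m ℂ) (i : m) :
    (Matrix.isHermitian_conjTranspose_mul_self M).eigenvalues i ≤ ‖M‖ ^ 2 := by
  have hspec := spectrum.norm_le_norm_mul_of_mem
    ((Matrix.isHermitian_conjTranspose_mul_self M).eigenvalues_mem_spectrum_real i)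
  have : Nonempty m := ⟨i⟩
  rw [CStarRing.norm_one, mul_one, Matrix.l2_opNorm_conjTranspose_mul_self, ← sq] at hspec
  exact (le_abs_self _).trans hspec

theorem prod_eigenvalues_conjTranspose_mul_self (M : Matrix m m ℂ) :
    ∏ i, (Matrix.isHermitian_conjTranspose_mul_self M).eigenvalues i = ‖M.det‖ ^ 2 := by
  have h := (Matrix.isHermitian_conjTranspose_mul_self M).det_eq_prod_eigenvalues
  rw [Matrix.det_mul, Matrix.det_conjTranspose, Complex.star_def, Complex.conj_mul',
    ← RCLike.ofReal_prod] at h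
  exact Complex.ofReal_injective (by simpa using h.symm)

theorem norm_det_le_norm_pow (M : Matrix m m ℂ) : ‖M.det‖ ≤ ‖M‖ ^ Fintype.card m := by
  refine le_of_sq_le_sq ?_ (by positivity)
  rw [← prod_eigenvalues_conjTranspose_mul_self, ← pow_mul, mul_comm, pow_mul,
    ← Finset.card_univ, ← Finset.prod_const]
  exact Finset.prod_le_prod
    (fun i _ => (Matrix.posSemidef_conjTranspose_mul_self M).eigenvalues_nonneg i)
    fun i _ => eigenvalues_conjTranspose_mul_self_le M i

theorem exists_eigenvalues_eq_norm_inv [Nonempty m] {M : Matrix m m ℂ} (hM : IsUnit M) :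
    ∃ i, (Matrix.isHermitian_conjTranspose_mul_self M).eigenvalues i = (‖M⁻¹‖ ^ 2)⁻¹ := by
  have hMM : IsUnit (Mᴴ * M) := ((Matrix.isUnit_conjTranspose M).2 hM).mul hM
  have hnorm : ‖M⁻¹‖ ^ 2 ∈ spectrum ℝ (Mᴴ * M)⁻¹ := by
    rw [Matrix.mul_inv_rev, ← Matrix.conjTranspose_nonsing_inv, sq, ← CStarRing.norm_self_mul_star]
    exact CStarAlgebra.norm_mem_spectrum_of_nonneg (mul_star_self_nonneg _)
  rwa [← Set.mem_range, ← Matrix.IsHermitian.spectrum_real_eq_range_eigenvalues, ← hMM.unit_spec,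
    spectrum.inv₀_mem_iff, Matrix.coe_units_inv, hMM.unit_spec]

theorem norm_inv_mul_norm_det_le (M : Matrix m m ℂ) :
    ‖M⁻¹‖ * ‖M.det‖ ≤ ‖M‖ ^ (Fintype.card m - 1) := by
  by_cases hdet : M.det = 0
  · simp [hdet]
  have hM : IsUnit M := (Matrix.isUnit_iff_isUnit_det M).2 (isUnit_iff_ne_zero.2 hdet)
  rcases isEmpty_or_nonempty m with _ | _
  · simp [Subsingleton.elim M⁻¹ 0]
  obtain ⟨i, hi⟩ := exists_eigenvalues_eq_norm_inv hM
  have hpos : 0 < ‖M⁻¹‖ ^ 2 := by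
    have : M⁻¹ ≠ 0 := ((Matrix.isUnit_nonsing_inv_iff).2 hM).ne_zero
    positivity
  refine le_of_sq_le_sq ?_ (by positivity)
  calc (‖M⁻¹‖ * ‖M.det‖) ^ 2
      = ∏ j ∈ Finset.univ.erase i,
          (Matrix.isHermitian_conjTranspose_mul_self M).eigenvalues j := by
        rw [mul_pow, ← prod_eigenvalues_conjTranspose_mul_self,
          ← Finset.mul_prod_erase _ _ (Finset.mem_univ i), hi, mul_inv_cancel_left₀ hpos.ne']
    _ ≤ ∏ _j ∈ Finset.univ.erase i, ‖M‖ ^ 2 :=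
        Finset.prod_le_prod
          (fun j _ => (Matrix.posSemidef_conjTranspose_mul_self M).eigenvalues_nonneg j)
          fun j _ => eigenvalues_conjTranspose_mul_self_le M j
    _ = (‖M‖ ^ (Fintype.card m - 1)) ^ 2 := by
        rw [Finset.prod_const, Finset.card_erase_of_mem (Finset.mem_univ i), Finset.card_univ,
          pow_right_comm]

theorem norm_one_submatrix_le {n α : Type*} [Fintype n] [DecidableEq α] {f : n → α} {g : ι → α}
    (hf : Function.Injective f) (hg : Function.Injective g) :
    ‖(1 : Matrix α α ℂ).submatrix f g‖ ≤ 1 := by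
  classical
  set V := (1 : Matrix α α ℂ).submatrix f g
  have hVV : Vᴴ * V = Matrix.diagonal fun k => if g k ∈ Set.range f then 1 else 0 := by
    ext k l
    simp only [V, Matrix.mul_apply, Matrix.conjTranspose_apply, Matrix.submatrix_apply,
      Matrix.one_apply, Matrix.diagonal_apply, apply_ite star, star_one, star_zero, ite_mul,
      one_mul, zero_mul]
    by_cases hk : g k ∈ Set.range f
    · obtain ⟨x, hx⟩ := hk
      simp only [← hx, hf.eq_iff, Finset.sum_ite_eq', Finset.mem_univ, ↓reduceIte, Set.mem_range,
        exists_eq]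
      simp [hx, hg.eq_iff]
    · rw [if_neg hk, ite_self]
      exact Finset.sum_eq_zero fun x _ => if_neg fun hx => hk ⟨x, hx⟩
  have hnorm : ‖Vᴴ * V‖ ≤ 1 := by
    rw [hVV, Matrix.l2_opNorm_diagonal, pi_norm_le_iff_of_nonneg zero_le_one]
    intro k
    split_ifs <;> simp
  rw [Matrix.l2_opNorm_conjTranspose_mul_self] at hnorm
  exact (le_abs_self _).trans (abs_le_one_iff_mul_self_le_one.2 hnorm)

open Classical in
/-- The operator norm of `M⁻¹`, with the value `∞` if `M` is singular (where `M⁻¹ = 0` in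
Mathlib). -/
def invNorm (M : Matrix m m ℂ) : ENNReal :=
  if IsUnit M then ENNReal.ofReal ‖M⁻¹‖ else ⊤

theorem invNorm_le_ofReal_iff {M : Matrix m m ℂ} {A : ℝ} (hA : 0 ≤ A) :
    invNorm M ≤ ENNReal.ofReal A ↔ IsUnit M ∧ ‖M⁻¹‖ ≤ A := by
  rw [invNorm]
  split_ifs with hM
  · rw [ENNReal.ofReal_le_ofReal_iff hA, and_iff_right hM]
  · simp [hM]

theorem ofReal_le_invNorm_iff {M : Matrix m m ℂ} {c : ℝ} :
    ENNReal.ofReal c ≤ invNorm M ↔ c * ‖M.det‖ ≤ ‖M.adjugate‖ := by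
  have hdet : IsUnit M ↔ M.det ≠ 0 := (Matrix.isUnit_iff_isUnit_det M).trans isUnit_iff_ne_zero
  rw [invNorm]
  split_ifs with hM
  · rw [ENNReal.ofReal_le_ofReal_iff (norm_nonneg _), Matrix.inv_def, Ring.inverse_eq_inv',
      norm_smul, norm_inv, inv_mul_eq_div, le_div_iff₀ (norm_pos_iff.2 (hdet.1 hM))]
  · simp [not_not.1 (hdet.not.1 hM)]

theorem isClosed_setOf_ofReal_le_invNorm (c : ℝ) :
    IsClosed {M : Matrix m m ℂ | ENNReal.ofReal c ≤ invNorm M} := by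
  simp only [ofReal_le_invNorm_iff]
  exact isClosed_le (continuous_const.mul continuous_id.matrix_det.norm)
    continuous_id.matrix_adjugate.norm

theorem norm_mul_mul_le {k l : Type*} [Fintype k] [Fintype l] [DecidableEq l] (X : Matrix k l ℂ)
    (Y : Matrix l m ℂ) (Z : Matrix m ι ℂ) : ‖X * Y * Z‖ ≤ ‖X‖ * ‖Y‖ * ‖Z‖ :=
  (Matrix.l2_opNorm_mul _ _).trans <| by gcongr; exact Matrix.l2_opNorm_mul _ _

theorem norm_one_add_le (X : Matrix m m ℂ) : ‖1 + X‖ ≤ 1 + ‖X‖ := by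
  have : ‖(1 : Matrix m m ℂ)‖ ≤ 1 := by
    simpa using norm_one_submatrix_le (ι := m) Function.injective_id Function.injective_id
  exact (norm_add_le _ _).trans (by gcongr)

theorem norm_inv_add_mul_mul_norm_det_le {M : Matrix m m ℂ} (hM : IsUnit M) (V : Matrix m ι ℂ)
    {W : Matrix ι m ℂ} (h : IsUnit (1 + W * M⁻¹ * V)) :
    ‖(M + V * W)⁻¹‖ * ‖(1 + W * M⁻¹ * V).det‖ ≤
      ‖M⁻¹‖ * (1 + ‖W‖ * ‖M⁻¹‖ * ‖V‖) ^ (Fintype.card ι + 1) := by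
  set D := 1 + W * M⁻¹ * V
  set q := ‖W‖ * ‖M⁻¹‖ * ‖V‖
  have hq : 0 ≤ q := by positivity
  have hDnorm : ‖D‖ ≤ 1 + q := (norm_one_add_le _).trans (by gcongr; exact norm_mul_mul_le _ _ _)
  have hdet : ‖D.det‖ ≤ (1 + q) ^ Fintype.card ι := (norm_det_le_norm_pow D).trans (by gcongr)
  have hadj : ‖D⁻¹‖ * ‖D.det‖ ≤ (1 + q) ^ Fintype.card ι :=
    calc ‖D⁻¹‖ * ‖D.det‖ ≤ ‖D‖ ^ (Fintype.card ι - 1) := norm_inv_mul_norm_det_le D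
      _ ≤ (1 + q) ^ (Fintype.card ι - 1) := by gcongr
      _ ≤ (1 + q) ^ Fintype.card ι := by gcongr <;> first | omega | linarith
  have hinv : ‖(M + V * W)⁻¹‖ ≤ ‖M⁻¹‖ + ‖M⁻¹‖ * q * ‖D⁻¹‖ := by
    rw [inv_add_mul_eq_sub hM V h]
    calc ‖M⁻¹ - M⁻¹ * V * D⁻¹ * W * M⁻¹‖
        ≤ ‖M⁻¹‖ + ‖M⁻¹ * V * D⁻¹ * W * M⁻¹‖ := norm_sub_le _ _
      _ ≤ ‖M⁻¹‖ + ‖M⁻¹‖ * ‖V‖ * ‖D⁻¹‖ * ‖W‖ * ‖M⁻¹‖ := by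
        gcongr
        refine (norm_mul_mul_le _ _ _).trans ?_
        gcongr
        exact norm_mul_mul_le _ _ _
      _ = ‖M⁻¹‖ + ‖M⁻¹‖ * q * ‖D⁻¹‖ := by ring
  calc ‖(M + V * W)⁻¹‖ * ‖D.det‖ ≤ (‖M⁻¹‖ + ‖M⁻¹‖ * q * ‖D⁻¹‖) * ‖D.det‖ := by gcongr
    _ = ‖M⁻¹‖ * (‖D.det‖ + q * (‖D⁻¹‖ * ‖D.det‖)) := by ring
    _ ≤ ‖M⁻¹‖ * ((1 + q) ^ Fintype.card ι + q * (1 + q) ^ Fintype.card ι) := by gcongr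
    _ = ‖M⁻¹‖ * (1 + q) ^ (Fintype.card ι + 1) := by ring

theorem mul_norm_det_le_of_ofReal_le_invNorm {M : Matrix m m ℂ} (hM : IsUnit M) {V : Matrix m ι ℂ}
    {W : Matrix ι m ℂ} {x : ℝ} (hx : ENNReal.ofReal x ≤ invNorm (M + V * W)) :
    x * ‖(1 + W * M⁻¹ * V).det‖ ≤
      ‖M⁻¹‖ * (1 + ‖W‖ * ‖M⁻¹‖ * ‖V‖) ^ (Fintype.card ι + 1) := by
  by_cases h : IsUnit (1 + W * M⁻¹ * V)
  · rw [invNorm, if_pos (isUnit_add_mul hM V h), ENNReal.ofReal_le_ofReal_iff (norm_nonneg _)] at hx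
    exact (mul_le_mul_of_nonneg_right hx (norm_nonneg _)).trans
      (norm_inv_add_mul_mul_norm_det_le hM V h)
  · rw [Matrix.isUnit_iff_isUnit_det, isUnit_iff_ne_zero, not_not] at h
    rw [h, norm_zero, mul_zero]
    positivity

end OperatorNorm

section Sublevel

variable {p : ℝ}

theorem lintegral_Icc_zero_one_enorm_rpow_neg (hp : p < 1) :
    ∫⁻ y in Set.Icc (0 : ℝ) 1, ‖y‖ₑ ^ (-p) = ENNReal.ofReal (1 / (1 - p)) := by
  have hint : IntegrableOn (fun y : ℝ => y ^ (-p)) (Set.Ioc 0 1) :=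
    (intervalIntegrable_iff_integrableOn_Ioc_of_le zero_le_one).1
      (intervalIntegral.intervalIntegrable_rpow' (by linarith))
  calc ∫⁻ y in Set.Icc (0 : ℝ) 1, ‖y‖ₑ ^ (-p)
      = ∫⁻ y in Set.Ioc (0 : ℝ) 1, ‖y‖ₑ ^ (-p) := setLIntegral_congr Ioc_ae_eq_Icc.symm
    _ = ∫⁻ y in Set.Ioc (0 : ℝ) 1, ENNReal.ofReal (y ^ (-p)) :=
        setLIntegral_congr_fun measurableSet_Ioc fun y hy => by
          rw [Real.enorm_of_nonneg hy.1.le, ENNReal.ofReal_rpow_of_pos hy.1]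
    _ = ENNReal.ofReal (∫ y in Set.Ioc (0 : ℝ) 1, y ^ (-p)) :=
        (ofReal_integral_eq_lintegral_ofReal hint <| (ae_restrict_mem measurableSet_Ioc).mono
          fun y hy => Real.rpow_nonneg hy.1.le _).symm
    _ = ENNReal.ofReal (1 / (1 - p)) := by
        rw [← intervalIntegral.integral_of_le zero_le_one, integral_rpow (Or.inl (by linarith)),
          Real.one_rpow, Real.zero_rpow (by linarith), sub_zero, neg_add_eq_sub]

theorem lintegral_Icc_enorm_rpow_neg_le (hp : p < 1) :
    ∫⁻ y in Set.Icc (-1 : ℝ) 1, ‖y‖ₑ ^ (-p) ≤ ENNReal.ofReal (2 / (1 - p)) := by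
  have hneg : ∫⁻ y in Set.Icc (-1 : ℝ) 0, ‖y‖ₑ ^ (-p) = ENNReal.ofReal (1 / (1 - p)) := by
    rw [← lintegral_Icc_zero_one_enorm_rpow_neg hp,
      ← (Measure.measurePreserving_neg (volume : Measure ℝ)).setLIntegral_comp_preimage
        measurableSet_Icc (by fun_prop)]
    simp
  rw [← Set.Icc_union_Icc_eq_Icc neg_one_lt_zero.le zero_le_one]
  refine (lintegral_union_le _ _ _).trans_eq ?_
  have : 0 ≤ 1 / (1 - p) := one_div_nonneg.2 (by linarith)
  rw [hneg, lintegral_Icc_zero_one_enorm_rpow_neg hp, ← ENNReal.ofReal_add this this,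
    ← add_div, one_add_one_eq_two]

theorem lintegral_Icc_enorm_sub_rpow_neg_le (hp0 : 0 ≤ p) (hp : p < 1) (x : ℝ) :
    ∫⁻ t in Set.Icc (-1 : ℝ) 1, ‖t - x‖ₑ ^ (-p) ≤ 2 + ENNReal.ofReal (2 / (1 - p)) := by
  set I := (Set.Icc (-1 : ℝ) 1).indicator fun y => ‖y‖ₑ ^ (-p)
  have hle : ∀ y : ℝ, ‖y‖ₑ ^ (-p) ≤ 1 + I y := by
    intro y
    by_cases hy : y ∈ Set.Icc (-1 : ℝ) 1
    · simp only [I, Set.indicator_of_mem hy]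
      exact le_add_self
    · simp only [I, Set.indicator_of_notMem hy, add_zero, ENNReal.rpow_neg, ENNReal.inv_le_one]
      have : 1 ≤ ‖y‖ₑ := by
        rw [Real.enorm_eq_ofReal_abs, ENNReal.one_le_ofReal]
        exact (not_le.1 (mt abs_le.1 hy)).le
      simpa only [ENNReal.one_rpow] using ENNReal.rpow_le_rpow this hp0
  calc ∫⁻ t in Set.Icc (-1 : ℝ) 1, ‖t - x‖ₑ ^ (-p)
      ≤ ∫⁻ t in Set.Icc (-1 : ℝ) 1, (1 + I (t - x)) := lintegral_mono fun t => hle _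
    _ = (∫⁻ _t in Set.Icc (-1 : ℝ) 1, 1) + ∫⁻ t in Set.Icc (-1 : ℝ) 1, I (t - x) :=
      lintegral_add_left measurable_const _
    _ ≤ 2 + ∫⁻ t, I (t - x) := by
      refine add_le_add (le_of_eq ?_) (setLIntegral_le_lintegral _ _)
      rw [setLIntegral_one, Real.volume_Icc]
      norm_num
    _ ≤ 2 + ENNReal.ofReal (2 / (1 - p)) := by
      rw [lintegral_sub_right_eq_self I x, lintegral_indicator measurableSet_Icc]
      gcongr
      exact lintegral_Icc_enorm_rpow_neg_le hp

theorem rpow_neg_le_of_le_mul {a b k : ENNReal} (hk : k ≠ 0) (hk' : k ≠ ⊤) (hp : 0 ≤ p)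
    (h : a ≤ k * b) : b ^ (-p) ≤ k ^ p * a ^ (-p) :=
  calc b ^ (-p) = k ^ p * (k ^ p * b ^ p)⁻¹ := by
        rw [ENNReal.mul_inv (Or.inl (by simp [hk, hk'])) (Or.inl (by simp [hk, hk'])),
          ENNReal.mul_inv_cancel_left (by simp [hk, hk']) (by simp [hk, hk']), ENNReal.rpow_neg]
    _ ≤ k ^ p * a ^ (-p) := by
        rw [ENNReal.rpow_neg, ← ENNReal.mul_rpow_of_nonneg _ _ hp]
        gcongr

theorem one_le_four_mul_norm_one_add_mul {ν : ℂ} (hν : ‖ν‖ ≤ 1 / 4) {t t₀ : ℝ}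
    (ht : t ∈ Set.Icc (-1 : ℝ) 1) (ht₀ : t₀ ∈ Set.Icc (-1 : ℝ) 1) :
    1 ≤ 4 * ‖1 + ((t - t₀ : ℝ) : ℂ) * ν‖ := by
  have hsmall : ‖((t - t₀ : ℝ) : ℂ) * ν‖ ≤ 2 * (1 / 4) := by
    rw [norm_mul, Complex.norm_real, Real.norm_eq_abs]
    gcongr
    exact abs_le.2 ⟨by linarith [ht.1, ht₀.2], by linarith [ht.2, ht₀.1]⟩
  have := norm_sub_le_norm_add (1 : ℂ) (((t - t₀ : ℝ) : ℂ) * ν)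
  rw [norm_one] at this
  linarith

theorem abs_sub_re_le_norm_one_add_mul {ν : ℂ} (hν : ν ≠ 0) (t t₀ : ℝ) :
    ‖ν‖ * |t - (t₀ - ν⁻¹).re| ≤ ‖1 + ((t - t₀ : ℝ) : ℂ) * ν‖ := by
  have hfactor : 1 + ((t - t₀ : ℝ) : ℂ) * ν = ν * ((t : ℂ) - (t₀ - ν⁻¹)) := by
    push_cast
    field_simp
    ring
  rw [hfactor, norm_mul]
  gcongr
  simpa using Complex.abs_re_le_norm ((t : ℂ) - (t₀ - ν⁻¹))

theorem lintegral_enorm_one_add_mul_rpow_neg_le (hp0 : 0 ≤ p) (hp : p < 1) (ν : ℂ) {t₀ : ℝ}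
    (ht₀ : t₀ ∈ Set.Icc (-1 : ℝ) 1) :
    ∫⁻ t in Set.Icc (-1 : ℝ) 1, ‖1 + ((t - t₀ : ℝ) : ℂ) * ν‖ₑ ^ (-p) ≤
      4 ^ p * (2 + ENNReal.ofReal (2 / (1 - p))) := by
  have lintegral_le {f : ℝ → ℝ} (hf : Measurable f)
      (hle : ∀ t ∈ Set.Icc (-1 : ℝ) 1, |f t| ≤ 4 * ‖1 + ((t - t₀ : ℝ) : ℂ) * ν‖) :
      ∫⁻ t in Set.Icc (-1 : ℝ) 1, ‖1 + ((t - t₀ : ℝ) : ℂ) * ν‖ₑ ^ (-p) ≤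
        4 ^ p * ∫⁻ t in Set.Icc (-1 : ℝ) 1, ‖f t‖ₑ ^ (-p) := by
    rw [← lintegral_const_mul _ (by fun_prop)]
    refine setLIntegral_mono' measurableSet_Icc fun t ht =>
      rpow_neg_le_of_le_mul (by norm_num) (by norm_num) hp0 ?_
    rw [← ofReal_norm, ← ofReal_norm, ← ENNReal.ofReal_ofNat, ← ENNReal.ofReal_mul (by norm_num)]
    exact ENNReal.ofReal_le_ofReal (hle t ht)
  rcases le_or_gt ‖ν‖ (1 / 4) with hν | hν
  · refine (lintegral_le (f := 1) measurable_one fun t ht => ?_).trans ?_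
    · simpa using one_le_four_mul_norm_one_add_mul hν ht ht₀
    · have : ∫⁻ t in Set.Icc (-1 : ℝ) 1, ‖(1 : ℝ → ℝ) t‖ₑ ^ (-p) = 2 := by
        simp [one_add_one_eq_two]
      rw [this]
      gcongr
      exact le_self_add
  · have hν0 : ν ≠ 0 := norm_pos_iff.1 (by linarith)
    refine (lintegral_le (f := fun t => t - (t₀ - ν⁻¹).re) (by fun_prop) fun t _ => ?_).trans ?_
    · nlinarith [abs_sub_re_le_norm_one_add_mul hν0 t t₀, abs_nonneg (t - (t₀ - ν⁻¹).re)]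
    · gcongr
      exact lintegral_Icc_enorm_sub_rpow_neg_le hp0 hp _

theorem measure_prod_le_le {α ι : Type*} [MeasurableSpace α] {m : Measure α} [Fintype ι]
    [Nonempty ι] {f : ι → α → ENNReal} (hf : ∀ i, AEMeasurable (f i) m) (hfin : ∀ i x, f i x ≠ ⊤)
    (hp : 0 < p) {c : ENNReal} (hc : ∀ i, ∫⁻ x, f i x ^ (-p) ∂m ≤ c) {η : ENNReal} (hη : η ≠ 0)
    (hη' : η ≠ ⊤) :
    m {x | ∏ i, f i x ≤ η} ≤ c * η ^ (p / Fintype.card ι) := by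
  have hN : (Fintype.card ι : ℝ) ≠ 0 := Nat.cast_ne_zero.2 Fintype.card_ne_zero
  set q : ℝ := p / Fintype.card ι with hq
  have hq0 : 0 < q := by positivity
  have hprod : ∀ x, (∏ i, f i x) ^ (-q) = ∏ i, (f i x ^ (-p)) ^ (1 / Fintype.card ι : ℝ) := by
    intro x
    rw [← ENNReal.prod_rpow_of_ne_top fun i _ => hfin i x]
    refine Finset.prod_congr rfl fun i _ => ?_
    rw [← ENNReal.rpow_mul, hq, mul_one_div, neg_div]
  have hint : ∫⁻ x, (∏ i, f i x) ^ (-q) ∂m ≤ c := by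
    simp only [hprod]
    calc ∫⁻ x, ∏ i, (f i x ^ (-p)) ^ (1 / Fintype.card ι : ℝ) ∂m
        ≤ ∏ i, (∫⁻ x, f i x ^ (-p) ∂m) ^ (1 / Fintype.card ι : ℝ) :=
          ENNReal.lintegral_prod_norm_pow_le Finset.univ (fun i _ => (hf i).pow_const _)
            (by simp [hN]) fun i _ => by positivity
      _ ≤ ∏ _i : ι, c ^ (1 / Fintype.card ι : ℝ) := by gcongr; exact hc _
      _ = c := by
          rw [Finset.prod_const, Finset.card_univ, ← ENNReal.rpow_natCast, ← ENNReal.rpow_mul,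
            one_div_mul_cancel hN, ENNReal.rpow_one]
  calc m {x | ∏ i, f i x ≤ η} ≤ m {x | η ^ (-q) ≤ (∏ i, f i x) ^ (-q)} := by
        refine measure_mono fun x hx => ?_
        simp only [Set.mem_ofPred_eq, ENNReal.rpow_neg, ENNReal.inv_le_inv]
        exact ENNReal.rpow_le_rpow hx hq0.le
    _ ≤ (∫⁻ x, (∏ i, f i x) ^ (-q) ∂m) / η ^ (-q) :=
        meas_ge_le_lintegral_div (by fun_prop) (by simp [hη, hη']) (by simp [hη, hη'])
    _ ≤ c * η ^ q := by
        rw [ENNReal.rpow_neg, ENNReal.div_eq_inv_mul, inv_inv, mul_comm]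
        gcongr

end Sublevel

section Wegner

open scoped Matrix.Norms.L2Operator

variable {m ι : Type*} [Fintype m] [DecidableEq m] [Fintype ι] [DecidableEq ι]

theorem norm_det_one_add_smul_le {M : Matrix m m ℂ} {V : Matrix m ι ℂ} {W : Matrix ι m ℂ}
    [Nonempty ι] {A b : ℝ} (hA : 1 ≤ A) (hM : invNorm M ≤ ENNReal.ofReal A) (hVW : ‖W‖ * ‖V‖ ≤ b)
    {τ : ℂ} (hτ : ‖τ‖ ≤ 2) {s : ℝ}
    (hs : ENNReal.ofReal (Real.exp s) ≤ invNorm (M + τ • (V * W))) :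
    ‖(1 + τ • (W * M⁻¹ * V)).det‖ ≤ ((1 + 2 * b) * A) ^ (3 * Fintype.card ι) * Real.exp (-s) := by
  obtain ⟨hunit, hMA⟩ := (invNorm_le_ofReal_iff (by linarith)).1 hM
  have hb : 0 ≤ b := le_trans (by positivity) hVW
  have hN : 1 ≤ Fintype.card ι := Fintype.card_pos
  have hbase : 1 + ‖τ • W‖ * ‖M⁻¹‖ * ‖V‖ ≤ (1 + 2 * b) * A :=
    calc 1 + ‖τ • W‖ * ‖M⁻¹‖ * ‖V‖ = 1 + ‖τ‖ * (‖W‖ * ‖V‖) * ‖M⁻¹‖ := by rw [norm_smul]; ring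
      _ ≤ A + 2 * b * A := by gcongr
      _ = (1 + 2 * b) * A := by ring
  have hA' : A ≤ (1 + 2 * b) * A := le_mul_of_one_le_left (by linarith) (by linarith)
  rw [← Matrix.mul_smul] at hs
  have hdet := mul_norm_det_le_of_ofReal_le_invNorm hunit hs
  rw [Matrix.smul_mul, Matrix.smul_mul] at hdet
  rw [Real.exp_neg, ← div_eq_mul_inv, le_div_iff₀' (Real.exp_pos s)]
  calc Real.exp s * ‖(1 + τ • (W * M⁻¹ * V)).det‖
      ≤ ‖M⁻¹‖ * (1 + ‖τ • W‖ * ‖M⁻¹‖ * ‖V‖) ^ (Fintype.card ι + 1) := hdet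
    _ ≤ ((1 + 2 * b) * A) * ((1 + 2 * b) * A) ^ (Fintype.card ι + 1) := by
        gcongr
        exact hMA.trans hA'
    _ = ((1 + 2 * b) * A) ^ (Fintype.card ι + 2) := by ring
    _ ≤ ((1 + 2 * b) * A) ^ (3 * Fintype.card ι) := by
        gcongr
        · linarith
        · omega

theorem volume_setOf_norm_det_one_add_smul_le [Nonempty ι] (Q : Matrix ι ι ℂ) {t₀ : ℝ}
    (ht₀ : t₀ ∈ Set.Icc (-1 : ℝ) 1) {p : ℝ} (hp0 : 0 < p) (hp1 : p < 1) {η : ℝ} (hη : 0 < η) :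
    volume.restrict (Set.Icc (-1) 1) {t : ℝ | ‖(1 + ((t - t₀ : ℝ) : ℂ) • Q).det‖ ≤ η} ≤
      4 ^ p * (2 + ENNReal.ofReal (2 / (1 - p))) *
        ENNReal.ofReal (η ^ (p / Fintype.card ι)) := by
  obtain ⟨ν, hν⟩ := exists_det_one_add_smul_eq_prod Q
  rw [← ENNReal.ofReal_rpow_of_pos hη]
  convert measure_prod_le_le (m := volume.restrict (Set.Icc (-1 : ℝ) 1))
    (f := fun i t => ‖1 + ((t - t₀ : ℝ) : ℂ) * ν i‖ₑ) (fun i => by fun_prop)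
    (fun _ _ => enorm_ne_top) hp0
    (fun i => lintegral_enorm_one_add_mul_rpow_neg_le hp0.le hp1 (ν i) ht₀)
    (ENNReal.ofReal_pos.2 hη).ne' ENNReal.ofReal_ne_top using 4 with t
  rw [hν, norm_prod, ← ENNReal.ofReal_le_ofReal_iff hη.le,
    ENNReal.ofReal_prod_of_nonneg fun i _ => norm_nonneg _]
  simp only [ofReal_norm]

theorem volume_setOf_exp_le_invNorm_add_smul_le [Nonempty ι] {M : Matrix m m ℂ} {V : Matrix m ι ℂ}
    {W : Matrix ι m ℂ} {A b : ℝ} (hA : 1 ≤ A) (hM : invNorm M ≤ ENNReal.ofReal A)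
    (hVW : ‖W‖ * ‖V‖ ≤ b) {t₀ : ℝ} (ht₀ : t₀ ∈ Set.Icc (-1 : ℝ) 1) (s : ℝ) :
    volume.restrict (Set.Icc (-1) 1)
        {t : ℝ | ENNReal.ofReal (Real.exp s) ≤ invNorm (M + ((t - t₀ : ℝ) : ℂ) • (V * W))} ≤
      12 * ENNReal.ofReal
        (((1 + 2 * b) * A) ^ (3 / 2 : ℝ) * Real.exp (-s / (2 * Fintype.card ι))) := by
  have hb : 0 ≤ b := le_trans (by positivity) hVW
  have hN : (Fintype.card ι : ℝ) ≠ 0 := Nat.cast_ne_zero.2 Fintype.card_ne_zero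
  set g := (1 + 2 * b) * A
  set η := g ^ (3 * Fintype.card ι) * Real.exp (-s) with hη
  have hg : 0 < g := by positivity
  have hconst : 4 ^ (1 / 2 : ℝ) * (2 + ENNReal.ofReal (2 / (1 - 1 / 2))) = 12 := by
    have hsqrt : (4 : ENNReal) ^ (1 / 2 : ℝ) = 2 := by
      rw [show (4 : ENNReal) = 2 ^ (2 : ℝ) by norm_num, ← ENNReal.rpow_mul]
      norm_num
    rw [hsqrt]
    norm_num
  have hpow : η ^ (1 / 2 / Fintype.card ι : ℝ) =
      g ^ (3 / 2 : ℝ) * Real.exp (-s / (2 * Fintype.card ι)) := by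
    rw [hη, Real.mul_rpow (by positivity) (by positivity), ← Real.rpow_natCast, ← Real.rpow_mul
      hg.le, ← Real.exp_mul]
    congr 2
    · push_cast
      field_simp
    · field_simp
  calc _ ≤ volume.restrict (Set.Icc (-1) 1)
        {t : ℝ | ‖(1 + ((t - t₀ : ℝ) : ℂ) • (W * M⁻¹ * V)).det‖ ≤ η} := by
        rw [Measure.restrict_apply' measurableSet_Icc, Measure.restrict_apply' measurableSet_Icc]
        refine measure_mono fun t ht => ⟨?_, ht.2⟩
        refine norm_det_one_add_smul_le hA hM hVW ?_ ht.1
        rw [Complex.norm_real, Real.norm_eq_abs]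
        exact abs_le.2 ⟨by linarith [ht.2.1, ht₀.2], by linarith [ht.2.2, ht₀.1]⟩
    _ ≤ 12 * ENNReal.ofReal (η ^ (1 / 2 / Fintype.card ι : ℝ)) := by
        rw [← hconst]
        exact volume_setOf_norm_det_one_add_smul_le _ ht₀ (by norm_num) (by norm_num)
          (by positivity)
    _ = _ := by rw [hpow]

end Wegner

section Model

open scoped Matrix.Norms.L2Operator

variable {d : ℕ} {u : (Fin d → ℤ) → ℝ} {F : Finset (Fin d → ℤ)}

theorem potential_eq_sum (hF : Function.support u ⊆ F) (ω : (Fin d → ℤ) → ℝ) (x : Fin d → ℤ) :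
    potential u ω x = ∑ k ∈ F, ω (x - k) * u k := by
  rw [potential, ← (Equiv.subLeft x).tsum_eq]
  simp only [Equiv.subLeft_apply, sub_sub_cancel]
  exact tsum_eq_sum fun k hk => by
    rw [Function.notMem_support.1 fun h => hk (hF h), mul_zero]

theorem potential_update (hF : Function.support u ⊆ F) (ω : (Fin d → ℤ) → ℝ) (n : Fin d → ℤ)
    (t t₀ : ℝ) (x : Fin d → ℤ) :
    potential u (Function.update ω n t) x =
      potential u (Function.update ω n t₀) x + (t - t₀) * u (x - n) := by
  rw [potential_eq_sum hF, potential_eq_sum hF, ← sub_eq_iff_eq_add', ← Finset.sum_sub_distrib,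
    Finset.sum_eq_single (x - n)]
  · simp only [sub_sub_cancel, Function.update_self, sub_mul]
  · intro k _ hk
    have : x - k ≠ n := fun h => hk (by rw [← h, sub_sub_cancel])
    simp only [Function.update_of_ne this, sub_self]
  · intro h
    rw [Function.notMem_support.1 fun h' => h (hF h'), mul_zero, mul_zero, sub_self]

theorem boxHamiltonian_update (lam : ℝ) (hF : Function.support u ⊆ F) (ω : (Fin d → ℤ) → ℝ)
    (n : Fin d → ℤ) (t t₀ : ℝ) (Γ : Finset (Fin d → ℤ)) :
    boxHamiltonian lam u (Function.update ω n t) Γ =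
      boxHamiltonian lam u (Function.update ω n t₀) Γ +
        ((t - t₀ : ℝ) : ℂ) • Matrix.diagonal fun x : Γ => ((lam * u (x - n) : ℝ) : ℂ) := by
  ext x y
  simp only [boxHamiltonian, Matrix.of_apply, Matrix.add_apply, Matrix.smul_apply, hamiltonian,
    potential_update hF ω n t t₀, Matrix.diagonal_apply, smul_eq_mul, Pi.single_apply,
    Subtype.coe_inj]
  split_ifs
  · push_cast
    ring
  · ring

theorem continuous_boxHamiltonian (lam : ℝ) (hF : Function.support u ⊆ F)
    (Γ : Finset (Fin d → ℤ)) : Continuous fun ω => boxHamiltonian lam u ω Γ := by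
  refine continuous_matrix fun x y => ?_
  simp only [boxHamiltonian, Matrix.of_apply, hamiltonian, potential_eq_sum hF]
  fun_prop

theorem resolventNorm_eq_invNorm (lam : ℝ) (u ω : (Fin d → ℤ) → ℝ) (Γ : Finset (Fin d → ℤ))
    (E : ℝ) :
    resolventNorm lam u ω Γ E = invNorm (boxHamiltonian lam u ω Γ - (E : ℂ) • 1) := by
  rw [resolventNorm, invNorm, Matrix.cstar_norm_def]

theorem measurableSet_setOf_le_resolventNorm (lam : ℝ) (hF : Function.support u ⊆ F)
    (Γ : Finset (Fin d → ℤ)) (E c : ℝ) :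
    MeasurableSet {ω | ENNReal.ofReal c ≤ resolventNorm lam u ω Γ E} := by
  simp only [resolventNorm_eq_invNorm]
  exact ((isClosed_setOf_ofReal_le_invNorm c).preimage
    ((continuous_boxHamiltonian lam hF Γ).sub continuous_const)).measurableSet

theorem volume_setOf_exp_le_resolventNorm_update_le {lam B A : ℝ} (hB : ∀ x, |lam * u x| ≤ B)
    (hA : 1 ≤ A) (hF : Function.support u ⊆ F) (hF' : F.Nonempty) {ω : (Fin d → ℤ) → ℝ}
    {n : Fin d → ℤ} {Γ : Finset (Fin d → ℤ)} {E t₀ : ℝ} (ht₀ : t₀ ∈ Set.Icc (-1 : ℝ) 1)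
    (hω : resolventNorm lam u (Function.update ω n t₀) Γ E ≤ ENNReal.ofReal A) (s : ℝ) :
    volume.restrict (Set.Icc (-1) 1) {t : ℝ | ENNReal.ofReal (Real.exp s) ≤
        resolventNorm lam u (Function.update ω n t) Γ E} ≤
      12 * ENNReal.ofReal
        (((1 + 2 * B) * A) ^ (3 / 2 : ℝ) * Real.exp (-s / (2 * F.card))) := by
  have : Nonempty F := hF'.to_subtype
  have hB0 : 0 ≤ B := (abs_nonneg _).trans (hB 0)
  have hinj : Function.Injective fun x : Γ => (x : Fin d → ℤ) - n :=
    (sub_left_injective).comp Subtype.val_injective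
  set w : (Fin d → ℤ) → ℂ := fun k => ((lam * u k : ℝ) : ℂ)
  have hw : ∀ k ∉ F, w k = 0 := fun k hk => by
    simp only [w, Function.notMem_support.1 fun h => hk (hF h), mul_zero, Complex.ofReal_zero]
  have hnorm : ‖Matrix.diagonal fun k : F => w k‖ ≤ B := by
    rw [Matrix.l2_opNorm_diagonal, pi_norm_le_iff_of_nonneg hB0]
    exact fun k => (Complex.norm_real _).trans_le (hB k)
  have hfactor := one_submatrix_mul_diagonal_mul_one_submatrix hw hinj
  set V := (1 : Matrix (Fin d → ℤ) (Fin d → ℤ) ℂ).submatrix (fun x : Γ => (x : Fin d → ℤ) - n)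
    (Subtype.val : F → _)
  set V' := (1 : Matrix (Fin d → ℤ) (Fin d → ℤ) ℂ).submatrix (Subtype.val : F → _)
    (fun x : Γ => (x : Fin d → ℤ) - n)
  have hVW : ‖(Matrix.diagonal fun k : F => w k) * V'‖ * ‖V‖ ≤ B :=
    calc _ ≤ ‖Matrix.diagonal fun k : F => w k‖ * ‖V'‖ * ‖V‖ := by
          gcongr
          exact Matrix.l2_opNorm_mul _ _
      _ ≤ B * 1 * 1 := by
          gcongr
          · exact norm_one_submatrix_le Subtype.val_injective hinj
          · exact norm_one_submatrix_le hinj Subtype.val_injective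
      _ = B := by ring
  rw [resolventNorm_eq_invNorm] at hω
  convert volume_setOf_exp_le_invNorm_add_smul_le hA hω hVW ht₀ s using 6 with t
  · rw [resolventNorm_eq_invNorm, boxHamiltonian_update lam hF ω n t t₀, hfactor,
      add_sub_right_comm]
  · rw [Fintype.card_coe]

end Model

section Probability

theorem map_update_prod_infinitePi {ι : Type*} [DecidableEq ι] {X : ι → Type*}
    [∀ i, MeasurableSpace (X i)] (μ : ∀ i, Measure (X i)) [∀ i, IsProbabilityMeasure (μ i)]
    (n : ι) :
    ((Measure.infinitePi μ).prod (μ n)).map (fun p => Function.update p.1 n p.2) =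
      Measure.infinitePi μ := by
  refine Measure.eq_infinitePi _ fun s t ht => ?_
  have hpre : (fun p : (∀ i, X i) × X n => Function.update p.1 n p.2) ⁻¹' (s : Set ι).pi t =
      ((s.erase n : Finset ι) : Set ι).pi t ×ˢ {x | n ∈ s → x ∈ t n} := by
    ext ⟨ω, x⟩
    simp only [Set.mem_preimage, Set.mem_pi, Finset.mem_coe, Set.mem_prod, Finset.mem_erase,
      Set.mem_ofPred_eq]
    refine ⟨fun h => ⟨fun i hi => ?_, fun hn => ?_⟩, fun h i hi => ?_⟩
    · simpa only [Function.update_of_ne hi.1] using h i hi.2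
    · simpa only [Function.update_self] using h n hn
    · rcases eq_or_ne i n with rfl | hin
      · simpa only [Function.update_self] using h.2 hi
      · simpa only [Function.update_of_ne hin] using h.1 i ⟨hin, hi⟩
  rw [Measure.map_apply measurable_update' (.pi s.countable_toSet fun i _ => ht i), hpre,
    Measure.prod_prod, Measure.infinitePi_pi _ fun i _ => ht i]
  by_cases hn : n ∈ s
  · simp only [hn, true_imp_iff, Set.ofPred_mem_eq, Finset.prod_erase_mul _ _ hn]
  · simp [hn]

theorem infinitePi_le_of_ae_update_le {ι : Type*} [DecidableEq ι] {X : ι → Type*}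
    [∀ i, MeasurableSpace (X i)] (μ : ∀ i, Measure (X i)) [∀ i, IsProbabilityMeasure (μ i)]
    {n : ι} {S : Set (∀ i, X i)} (hS : MeasurableSet S) {c : ENNReal}
    (h : ∀ᵐ ω ∂Measure.infinitePi μ, μ n {x | Function.update ω n x ∈ S} ≤ c) :
    Measure.infinitePi μ S ≤ c := by
  have hupdate : Measurable fun p : (∀ i, X i) × X n => Function.update p.1 n p.2 :=
    measurable_update'
  calc Measure.infinitePi μ S
      = ∫⁻ ω, μ n {x | Function.update ω n x ∈ S} ∂Measure.infinitePi μ := by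
        rw [← map_update_prod_infinitePi μ n, Measure.map_apply hupdate hS,
          Measure.prod_apply (hupdate hS), map_update_prod_infinitePi]
        rfl
    _ ≤ ∫⁻ _, c ∂Measure.infinitePi μ := lintegral_mono_ae h
    _ = c := by rw [lintegral_const, measure_univ, mul_one]

theorem withDensity_le_smul_restrict {α : Type*} [MeasurableSpace α] {m : Measure α}
    {f : α → ENNReal} {K : ENNReal} {S : Set α} (hS : MeasurableSet S) (hK : ∀ x, f x ≤ K)
    (hf : Function.support f ⊆ S) : m.withDensity f ≤ K • m.restrict S := by
  rw [← withDensity_const, ← withDensity_indicator hS]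
  refine withDensity_mono (Filter.Eventually.of_forall fun x => ?_)
  by_cases hx : x ∈ S
  · rw [Set.indicator_of_mem hx]
    exact hK x
  · rw [Function.notMem_support.1 fun h => hx (hf h)]
    exact zero_le

theorem withDensity_ofReal_le_smul_restrict {α : Type*} [MeasurableSpace α] {m : Measure α}
    {ρ : α → ℝ} {K : ℝ} {S : Set α} (hS : MeasurableSet S) (hK : ∀ x, ρ x ≤ K)
    (hρ : Function.support ρ ⊆ S) :
    m.withDensity (fun x => ENNReal.ofReal (ρ x)) ≤ ENNReal.ofReal K • m.restrict S :=
  withDensity_le_smul_restrict hS (fun x => ENNReal.ofReal_le_ofReal (hK x))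
    ((Function.support_comp_subset ENNReal.ofReal_zero ρ).trans hρ)

end Probability

section Tail

variable {d : ℕ}

theorem zero_mem_cube {r : ℝ} (hr : 0 ≤ r) : (0 : Fin d → ℤ) ∈ cube r 0 :=
  (mem_cube r 0 0).2 fun i => by simpa using hr

theorem card_cube_le {r : ℝ} (hr : 1 ≤ r) (x : Fin d → ℤ) :
    ((cube r x).card : ℝ) ≤ 3 ^ d * r ^ d := by
  have hfloor : (0 : ℤ) ≤ ⌊r⌋ := Int.floor_nonneg.2 (by linarith)
  have hside : (2 * ⌊r⌋ + 1 : ℝ) ≤ 3 * r := by linarith [Int.floor_le r]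
  have hcard : ∀ i, ((Finset.Icc (x i - ⌊r⌋) (x i + ⌊r⌋)).card : ℝ) = 2 * ⌊r⌋ + 1 := fun i => by
    rw [Int.card_Icc, ← Int.cast_natCast, Int.toNat_of_nonneg (by omega)]
    push_cast
    ring
  have : (0 : ℝ) ≤ ⌊r⌋ := Int.cast_nonneg hfloor
  rw [cube, Pi.card_Icc, Nat.cast_prod, Finset.prod_congr rfl fun i _ => hcard i,
    Finset.prod_const, Finset.card_univ, Fintype.card_fin, ← mul_pow]
  gcongr

theorem le_mul_exp_of_le_one {p M q A₀ A Y : ℝ} (hp0 : 0 ≤ p) (hp1 : p ≤ 1) (hM : 1 ≤ M)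
    (hA₀ : 1 < A₀) (hA : A₀ ≤ A) (hp : p ≤ M * A ^ q * Real.exp (-Y)) :
    p ≤ M * A₀ ^ q * Real.exp (-(Real.log A₀ * Y / Real.log A)) := by
  have hA1 : 1 < A := hA₀.trans_le hA
  have hlog₀ : 0 < Real.log A₀ := Real.log_pos hA₀
  have hlog : 0 < Real.log A := Real.log_pos hA1
  set θ := Real.logb A A₀ with hθ
  have hθ0 : 0 ≤ θ := div_nonneg hlog₀.le hlog.le
  have hθ1 : θ ≤ 1 := (div_le_one hlog).2 (Real.log_le_log (by linarith) hA)
  calc p ≤ p ^ θ := Real.self_le_rpow_of_le_one hp0 hp1 hθ1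
    _ ≤ (M * A ^ q * Real.exp (-Y)) ^ θ := by gcongr
    _ = M ^ θ * (A ^ θ) ^ q * Real.exp (-(θ * Y)) := by
        rw [Real.mul_rpow (by positivity) (by positivity), Real.mul_rpow (by linarith)
          (by positivity), ← Real.rpow_mul (by linarith), mul_comm q, Real.rpow_mul (by linarith),
          ← Real.exp_mul, neg_mul, mul_comm Y]
    _ ≤ M * A₀ ^ q * Real.exp (-(Real.log A₀ * Y / Real.log A)) := by
        rw [Real.rpow_logb (by linarith) hA1.ne' (by linarith), hθ, Real.logb, div_mul_eq_mul_div]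
        gcongr
        exact Real.rpow_le_self_of_one_le hM hθ1

theorem le_exp_neg_half_of_le_mul_exp_neg {C δ l : ℝ} (hC : 1 ≤ C) (hδ : 0 < δ) (hl : 0 < l)
    {P : ℝ → ENNReal} (hP1 : ∀ s, P s ≤ 1)
    (hP : ∀ s, 0 ≤ s → P s ≤ ENNReal.ofReal (C * Real.exp (-(δ * s / l)))) :
    (∀ s, P s ≤ ENNReal.ofReal (C * Real.exp (-(δ / 2 * s / l)))) ∧
      ∀ s, 2 * Real.log C / δ * l ≤ s → P s ≤ ENNReal.ofReal (Real.exp (-(δ / 2 * s / l))) := by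
  have hlogC : 0 ≤ Real.log C := Real.log_nonneg hC
  have hrate (s : ℝ) : δ / 2 * s / l = δ * s / l / 2 := by ring
  simp only [hrate]
  refine ⟨fun s => ?_, fun s hs => ?_⟩
  · rcases le_total 0 s with hs | hs
    · refine (hP s hs).trans (ENNReal.ofReal_le_ofReal ?_)
      gcongr C * Real.exp (-?_)
      exact half_le_self (by positivity)
    · have hneg : δ * s / l ≤ 0 :=
        div_nonpos_of_nonpos_of_nonneg (mul_nonpos_of_nonneg_of_nonpos hδ.le hs) hl.le
      exact (hP1 s).trans <| ENNReal.one_le_ofReal.2 <|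
        one_le_mul_of_one_le_of_one_le hC (Real.one_le_exp (by linarith))
  · have hlarge : 2 * Real.log C ≤ δ * s / l := by
      rwa [le_div_iff₀ hl, mul_comm δ, ← div_le_iff₀ hδ, mul_div_right_comm]
    refine (hP s (le_trans (by positivity) hs)).trans (ENNReal.ofReal_le_ofReal ?_)
    calc C * Real.exp (-(δ * s / l)) = Real.exp (Real.log C + -(δ * s / l)) := by
          rw [Real.exp_add, Real.exp_log (by linarith)]
      _ ≤ Real.exp (-(δ * s / l / 2)) := Real.exp_le_exp.2 (by linarith)

theorem tail_bounds_with_volume_factor {d : ℕ} {C R L : ℝ} (hC : 0 < C) (hR : 0 ≤ R) (hL : 0 ≤ L)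
    {P : ℝ → ENNReal} {Q : ℝ → ℝ} (hQ : ∀ s, 0 ≤ Q s)
    (h : (∀ s, P s ≤ ENNReal.ofReal (C * Q s)) ∧ ∀ s, C * R ≤ s → P s ≤ ENNReal.ofReal (Q s)) :
    (∀ s, P s ≤ ENNReal.ofReal (C / Real.log 2 * (2 * L + 1) ^ d * Q s)) ∧
      ∀ s, C / Real.log 2 * R * Real.log (L + 2) ≤ s → P s ≤ ENNReal.ofReal (Q s) := by
  have hlog2 : 0 < Real.log 2 := Real.log_pos one_lt_two
  have hC' : C ≤ C / Real.log 2 := le_div_self hC.le hlog2 (by linarith [Real.log_two_lt_d9])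
  refine ⟨fun s => (h.1 s).trans (ENNReal.ofReal_le_ofReal ?_), fun s hs => h.2 s (le_trans ?_ hs)⟩
  · have := hQ s
    gcongr
    exact hC'.trans (le_mul_of_one_le_right (by positivity) (one_le_pow₀ (by linarith)))
  · calc C * R = C / Real.log 2 * R * Real.log 2 := by field_simp
      _ ≤ C / Real.log 2 * R * Real.log (L + 2) := by
        gcongr
        linarith

variable {lam B K : ℝ} {u : (Fin d → ℤ) → ℝ} {μ : Measure ℝ} [IsProbabilityMeasure μ]
  {n : Fin d → ℤ} {Γ : Finset (Fin d → ℤ)} {E : ℝ}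

theorem ModificationBound.ae_exists_update_le {L A : ℝ} (hL : 0 ≤ L)
    (h : ModificationBound lam u μ E L A) :
    ∀ᵐ ω ∂iidLaw d μ, ∃ t ∈ Set.Icc (-1 : ℝ) 1,
      resolventNorm lam u (Function.update ω 0 t) (cube L 0) E ≤ ENNReal.ofReal A := by
  filter_upwards [h] with ω hω
  obtain ⟨ω', hω', hmem, hle⟩ := hω 0 (zero_mem_cube hL)
  exact ⟨ω' 0, hmem, by rwa [← Function.eq_update_iff.2 ⟨rfl, hω'⟩]⟩

instance : IsProbabilityMeasure (iidLaw d μ) :=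
  inferInstanceAs (IsProbabilityMeasure (Measure.infinitePi fun _ : Fin d → ℤ => μ))

theorem iidLaw_setOf_exp_le_resolventNorm_le (hB : ∀ x, |lam * u x| ≤ B)
    (hμ : μ ≤ ENNReal.ofReal K • volume.restrict (Set.Icc (-1) 1)) {A : ℝ} (hA : 1 ≤ A)
    {F : Finset (Fin d → ℤ)} (hF : Function.support u ⊆ F) (hF' : F.Nonempty)
    (hmod : ∀ᵐ ω ∂iidLaw d μ, ∃ t ∈ Set.Icc (-1 : ℝ) 1,
      resolventNorm lam u (Function.update ω n t) Γ E ≤ ENNReal.ofReal A) (s : ℝ) :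
    iidLaw d μ {ω | ENNReal.ofReal (Real.exp s) ≤ resolventNorm lam u ω Γ E} ≤
      ENNReal.ofReal
        (12 * K * (((1 + 2 * B) * A) ^ (3 / 2 : ℝ) * Real.exp (-s / (2 * F.card)))) := by
  have hB0 : 0 ≤ B := (abs_nonneg _).trans (hB 0)
  rw [ENNReal.ofReal_mul' (by positivity), mul_comm 12 K, ENNReal.ofReal_mul' (by norm_num),
    ENNReal.ofReal_ofNat, mul_assoc]
  refine infinitePi_le_of_ae_update_le (n := n) _
    (measurableSet_setOf_le_resolventNorm lam hF Γ E _) ?_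
  filter_upwards [hmod] with ω ⟨t₀, ht₀, hω⟩
  refine (hμ _).trans ?_
  rw [Measure.smul_apply, smul_eq_mul]
  gcongr
  exact volume_setOf_exp_le_resolventNorm_update_le hB hA hF hF' ht₀ hω s

theorem iidLaw_setOf_exp_le_resolventNorm_le_exp_div_log (hB : ∀ x, |lam * u x| ≤ B)
    (hμ : μ ≤ ENNReal.ofReal K • volume.restrict (Set.Icc (-1) 1)) {A₀ A : ℝ} (hA₀ : 1 < A₀)
    (hA : A₀ ≤ A) {r : ℝ} (hr : 1 ≤ r)
    (hsupp : Function.support u ⊆ (cube r (0 : Fin d → ℤ) : Set (Fin d → ℤ)))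
    (hmod : ∀ᵐ ω ∂iidLaw d μ, ∃ t ∈ Set.Icc (-1 : ℝ) 1,
      resolventNorm lam u (Function.update ω n t) Γ E ≤ ENNReal.ofReal A)
    {s : ℝ} (hs : 0 ≤ s) :
    iidLaw d μ {ω | ENNReal.ofReal (Real.exp s) ≤ resolventNorm lam u ω Γ E} ≤
      ENNReal.ofReal (max 1 (12 * K * (1 + 2 * B) ^ (3 / 2 : ℝ)) * A₀ ^ (3 / 2 : ℝ) *
        Real.exp (-(Real.log A₀ / (2 * 3 ^ d) * s / (Real.log A * r ^ d)))) := by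
  have hB0 : 0 ≤ B := (abs_nonneg _).trans (hB 0)
  have hlog₀ : 0 < Real.log A₀ := Real.log_pos hA₀
  have hA1 : 1 < A := hA₀.trans_le hA
  have hlog : 0 < Real.log A := Real.log_pos hA1
  have hcube : (cube r (0 : Fin d → ℤ)).Nonempty := ⟨0, zero_mem_cube (by linarith)⟩
  set P := iidLaw d μ {ω | ENNReal.ofReal (Real.exp s) ≤ resolventNorm lam u ω Γ E}
  have hwegner : P.toReal ≤ max 1 (12 * K * (1 + 2 * B) ^ (3 / 2 : ℝ)) * A ^ (3 / 2 : ℝ) *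
      Real.exp (-(s / (2 * (cube r (0 : Fin d → ℤ)).card))) := by
    refine ENNReal.toReal_le_of_le_ofReal (by positivity)
      ((iidLaw_setOf_exp_le_resolventNorm_le hB hμ (by linarith) hsupp hcube hmod s).trans
        (ENNReal.ofReal_le_ofReal ?_))
    rw [Real.mul_rpow (by positivity) (by linarith), ← mul_assoc, ← mul_assoc, neg_div]
    gcongr
    exact le_max_right _ _
  refine ENNReal.le_ofReal_iff_toReal_le (measure_ne_top _ _) (by positivity) |>.2 ?_
  refine (le_mul_exp_of_le_one ENNReal.toReal_nonneg measureReal_le_one (le_max_left _ _) hA₀ hA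
    hwegner).trans ?_
  have : (0 : ℝ) < (cube r (0 : Fin d → ℤ)).card := Nat.cast_pos.2 hcube.card_pos
  have hrate : Real.log A₀ / (2 * 3 ^ d) * s / (Real.log A * r ^ d) ≤
      Real.log A₀ * (s / (2 * (cube r (0 : Fin d → ℤ)).card)) / Real.log A :=
    calc Real.log A₀ / (2 * 3 ^ d) * s / (Real.log A * r ^ d)
        = Real.log A₀ * (s / (2 * (3 ^ d * r ^ d))) / Real.log A := by field_simp
      _ ≤ _ := by
        gcongr
        exact card_cube_le hr 0
  gcongr

theorem exists_abs_le_of_finite_support {α : Type*} (f : α → ℝ) :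
    ∃ B, f.support.Finite → ∀ x, |f x| ≤ B := by
  by_cases hf : f.support.Finite
  · obtain ⟨B, hB⟩ := (hf.image fun x => |f x|).bddAbove
    refine ⟨max 0 B, fun _ x => ?_⟩
    by_cases hx : f x = 0
    · rw [hx, abs_zero]
      exact le_max_left _ _
    · exact (hB ⟨x, hx, rfl⟩).trans (le_max_right _ _)
  · exact ⟨0, fun h => absurd h hf⟩

end Tail

end AlloyType

end

theorem mainTheorem10_general {d : ℕ} (lam : ℝ) (u : (Fin d → ℤ) → ℝ) (μ : Measure ℝ)
    [IsProbabilityMeasure μ] {K : ℝ}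
    (hμ : μ ≤ ENNReal.ofReal K • volume.restrict (Set.Icc (-1) 1)) {A₀ : ℝ} (hA₀ : 1 < A₀) :
    ∃ δ : ℝ, 0 < δ ∧ ∃ C : ℝ, 0 < C ∧
      ∀ (Γ : Finset (Fin d → ℤ)) (n : Fin d → ℤ) (E r A : ℝ), 1 ≤ r → A₀ ≤ A →
        Function.support u ⊆ (AlloyType.cube r (0 : Fin d → ℤ) : Set (Fin d → ℤ)) →
        (∀ᵐ ω ∂AlloyType.iidLaw d μ, ∃ t ∈ Set.Icc (-1 : ℝ) 1,
          AlloyType.resolventNorm lam u (Function.update ω n t) Γ E ≤ ENNReal.ofReal A) →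
        (∀ s : ℝ,
          AlloyType.iidLaw d μ
              {ω | ENNReal.ofReal (Real.exp s) ≤ AlloyType.resolventNorm lam u ω Γ E} ≤
            ENNReal.ofReal (C * Real.exp (-(δ * s / (Real.log A * r ^ d))))) ∧
        (∀ s : ℝ, C * (r ^ d * Real.log A) ≤ s →
          AlloyType.iidLaw d μ
              {ω | ENNReal.ofReal (Real.exp s) ≤ AlloyType.resolventNorm lam u ω Γ E} ≤
            ENNReal.ofReal (Real.exp (-(δ * s / (Real.log A * r ^ d))))) := by
  obtain ⟨B, hB⟩ := AlloyType.exists_abs_le_of_finite_support fun x => lam * u x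
  set C₀ := max 1 (12 * K * (1 + 2 * B) ^ (3 / 2 : ℝ)) * A₀ ^ (3 / 2 : ℝ)
  set δ := Real.log A₀ / (2 * 3 ^ d)
  have hδ : 0 < δ := div_pos (Real.log_pos hA₀) (by positivity)
  have hC₀ : 1 ≤ C₀ := one_le_mul_of_one_le_of_one_le (le_max_left _ _)
    (Real.one_le_rpow hA₀.le (by norm_num))
  have hlogC₀ : 0 ≤ 2 * Real.log C₀ / δ := by have := Real.log_nonneg hC₀; positivity
  refine ⟨δ / 2, by positivity, C₀ + 2 * Real.log C₀ / δ, by linarith, ?_⟩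
  intro Γ n E r A hr hA hsupp hmod
  have hfin : (fun x => lam * u x).support.Finite := (Finset.finite_toSet _).subset
    ((Function.support_mul_subset_right _ _).trans hsupp)
  have hl : 0 < Real.log A * r ^ d := mul_pos (Real.log_pos (hA₀.trans_le hA)) (by positivity)
  obtain ⟨hall, hlarge⟩ := AlloyType.le_exp_neg_half_of_le_mul_exp_neg hC₀ hδ hl
    (fun _ => prob_le_one) fun s hs => AlloyType.iidLaw_setOf_exp_le_resolventNorm_le_exp_div_log
      (hB hfin) hμ hA₀ hA hr hsupp hmod hs
  refine ⟨fun s => (hall s).trans (ENNReal.ofReal_le_ofReal ?_), fun s hs => hlarge s ?_⟩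
  · gcongr
    linarith
  · refine le_trans ?_ hs
    rw [mul_comm (r ^ d)]
    gcongr
    linarith

theorem mainTheorem10 (d : ℕ) (hd : 1 ≤ d) (lam : ℝ) (hlam : 0 < lam)
    (u : (Fin d → ℤ) → ℝ)
    (μ : Measure ℝ) [IsProbabilityMeasure μ] (ρ : ℝ → ℝ) (hρm : Measurable ρ)
    (hρ0 : ∀ x, 0 ≤ ρ x) (hρb : ∃ K : ℝ, ∀ x, ρ x ≤ K)
    (hρs : Function.support ρ ⊆ Set.Icc (-1 : ℝ) 1)
    (hμ : μ = volume.withDensity fun x => ENNReal.ofReal (ρ x))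
    (A₀ : ℝ) (hA₀ : 1 < A₀) :
    ∃ δ : ℝ, 0 < δ ∧ ∃ C : ℝ, 0 < C ∧
      ∀ E L r A : ℝ, 0 < L → 1 ≤ r → A₀ ≤ A →
        AlloyType.RemovalBound lam u μ E L r A →
        AlloyType.ModificationBound lam u μ E L A →
        Function.support u ⊆ (AlloyType.cube r (0 : Fin d → ℤ) : Set (Fin d → ℤ)) →
        (∀ s : ℝ,
          AlloyType.iidLaw d μ
              {ω | ENNReal.ofReal (Real.exp s) ≤
                AlloyType.resolventNorm lam u ω (AlloyType.cube L 0) E} ≤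
            ENNReal.ofReal
              (C * (2 * L + 1) ^ d * Real.exp (-(δ * s / (Real.log A * r ^ d))))) ∧
        (∀ s : ℝ, C * r ^ d * Real.log A * Real.log (L + 2) ≤ s →
          AlloyType.iidLaw d μ
              {ω | ENNReal.ofReal (Real.exp s) ≤
                AlloyType.resolventNorm lam u ω (AlloyType.cube L 0) E} ≤
            ENNReal.ofReal (Real.exp (-(δ * s / (Real.log A * r ^ d))))) := by
  obtain ⟨K, hK⟩ := hρb
  obtain ⟨δ, hδ, C, hC, hbound⟩ := mainTheorem10_general lam u μ
    (hμ.trans_le (AlloyType.withDensity_ofReal_le_smul_restrict measurableSet_Icc hK hρs)) hA₀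
  refine ⟨δ, hδ, C / Real.log 2, div_pos hC (Real.log_pos one_lt_two), ?_⟩
  intro E L r A hL hr hA _ hmod hsupp
  have hR : 0 ≤ r ^ d * Real.log A :=
    mul_nonneg (by positivity) (Real.log_nonneg (hA₀.le.trans hA))
  simpa only [mul_assoc] using AlloyType.tail_bounds_with_volume_factor (d := d) hC hR hL.le
    (fun _ => (Real.exp_pos _).le)
    (hbound (AlloyType.cube L 0) 0 E r A hr hA hsupp (hmod.ae_exists_update_le hL.le))
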